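/- Let $d\ge 1$ and $p\in[0,1]$. In the parking model on $\mathbb{Z}^d$, each vertex is initially, independently of the others, occupied by a car with probability $p$, or is a vacant parking spot with probability $1-p$. Independently, cars perform independent simple symmetric discrete-time random walks on $\mathbb{Z}^d$ (all moving simultaneously at times $t=1,2,\dots$). When an unparked car moves to a vacant spot it parks there, making the spot occupied forever; if several unparked cars move to the same vacant spot at the same time $t$, only one of them parks, namely the one with the largest value at time $t$ of its tie-breaking variable, where the tie-breaking variables (one for each car and each time) are i.i.d. uniform on $[0,1]$ and independent of everything else. A car that moves to a vertex without parking there keeps walking at the next time step; a parked car never moves again. Write $\mathbb{P}_p,\mathbb{E}_p$ for the corresponding probability measure and expectation. A car *visits* a vertex $x$ at time $t\ge1$ if it is unparked at time $t-1$ and moves to $x$ at time $t$ (whether or not it parks at $x$). Let $V_t$ be the number of visits to the origin by all cars through time $t$, where visits of different cars, and visits of the same car at different times, are counted separately, and let $V=\lim_{t\to\infty}V_t\in[0,\infty]$ be the total number of visits to the origin. Then for all $p\in[0,1]$, $$\mathbb{E}_pV\ge p+p^2,$$ where $\mathbb{E}_pV\in[0,\infty]$. Moreover $\mathbb{E}_pV<\infty$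 for all sufficiently small $p>0$, and as $p\downarrow0$, $$\mathbb{E}_pV=p+O\left(p^2(\log p^{-1})^{(d+2)/d}\right),$$ where the constant in the $O$ term depends only on $d$. -/

import Mathlib

open MeasureTheory ProbabilityTheory Filter Topology Asymptotics
open scoped ENNReal unitInterval

/-- The vertices of `ℤ^d`. -/
abbrev Site (d : ℕ) : Type := Fin d → ℤ

/-- Labels of the `2d` unit steps of `ℤ^d`: a coordinate axis and a sign. -/
abbrev StepLabel (d : ℕ) : Type := Fin d × Bool

/-- The unit vector `e_i` (for the label `(i, true)`) or `-e_i` (for the label `(i, false)`). -/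
def stepVec {d : ℕ} (e : StepLabel d) : Site d :=
  Pi.single e.1 (if e.2 then 1 else -1)

/-- The randomness attached to one vertex: whether a car starts there (`true`) or the vertex is
a vacant parking spot (`false`); the steps of the walk of the car placed there; and, for every
time, the number in `[0,1]` used to break ties. -/
abbrev SiteData (d : ℕ) : Type := Bool × (ℕ → StepLabel d) × (ℕ → I)

/-- The sample space of the parking model. -/
abbrev ParkingSpace (d : ℕ) : Type := Site d → SiteData d

/-- The law of the data of one vertex: a car with probability `p`, i.i.d. uniform unit steps, and
i.i.d. uniform `[0,1]` variables, the three components being independent. -/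
noncomputable def siteLaw (d : ℕ) [NeZero d] (p : I) : Measure (SiteData d) :=
  (bernoulliMeasure true false p).prod
    ((Measure.infinitePi fun _ : ℕ => (PMF.uniformOfFintype (StepLabel d)).toMeasure).prod
      (Measure.infinitePi fun _ : ℕ => (volume : Measure I)))

instance (d : ℕ) [NeZero d] (p : I) : IsProbabilityMeasure (siteLaw d p) := by
  unfold siteLaw
  infer_instance

/-- The measure `ℙ_p`: the data of the different vertices are i.i.d. -/
noncomputable def parkingMeasure (d : ℕ) [NeZero d] (p : I) : Measure (ParkingSpace d) :=
  Measure.infinitePi fun _ : Site d => siteLaw d p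

instance (d : ℕ) [NeZero d] (p : I) : IsProbabilityMeasure (parkingMeasure d p) := by
  unfold parkingMeasure
  infer_instance

namespace ParkingSpace

variable {d : ℕ} (ω : ParkingSpace d)

/-- A car starts at `v`. Otherwise `v` is initially a vacant parking spot. -/
def HasCar (v : Site d) : Prop := (ω v).1 = true

/-- The position at time `t` of the simple random walk started at `v`, which the car starting at
`v` follows as long as it is unparked. -/
def walk (v : Site d) (t : ℕ) : Site d :=
  v + ∑ s ∈ Finset.range t, stepVec ((ω v).2.1 s)

/-- The uniform variable of the car from `v` for breaking ties at time `t`. -/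
def tieBreak (v : Site d) (t : ℕ) : I := (ω v).2.2 t

end ParkingSpace

/-- A configuration: the cars that are unparked (named by their starting vertices) and the
spots that are vacant. -/
structure ParkingState (d : ℕ) where
  unparked : Set (Site d)
  vacant : Set (Site d)

namespace ParkingSpace

variable {d : ℕ} (ω : ParkingSpace d)

/-- If the configuration just before time `t` is `S`, then the car from `v` parks at time `t`:
it is unparked, it moves to a vacant spot, and among all unparked cars that move to this spot at
time `t` it has the largest tie-breaking variable (almost surely the variables are distinct). -/
def ParksAt (S : ParkingState d) (t : ℕ) (v : Site d) : Prop :=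
  v ∈ S.unparked ∧ ω.walk v t ∈ S.vacant ∧
    ∀ u ∈ S.unparked, ω.walk u t = ω.walk v t → ω.tieBreak u t ≤ ω.tieBreak v t

/-- The configuration at time `t`, after the moves and the parking at time `t`. -/
def state : ℕ → ParkingState d
  | 0 => { unparked := {v | ω.HasCar v}
           vacant := {x | ¬ ω.HasCar x} }
  | t + 1 =>
    { unparked := {v | v ∈ (state t).unparked ∧ ¬ ω.ParksAt (state t) (t + 1) v}
      vacant := {x | x ∈ (state t).vacant ∧
        ¬ ∃ v, ω.ParksAt (state t) (t + 1) v ∧ ω.walk v (t + 1) = x} }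

/-- The car from `v` visits `x` at time `t ≥ 1`: it is unparked at time `t - 1` and moves to `x`
at time `t`. -/
def Visits (v x : Site d) (t : ℕ) : Prop :=
  1 ≤ t ∧ v ∈ (ω.state (t - 1)).unparked ∧ ω.walk v t = x

open Classical in
/-- `V_t`, the number of visits by all cars to the origin through time `t`. -/
noncomputable def visitsUpTo (t : ℕ) : ℝ≥0∞ :=
  ∑ s ∈ Finset.Icc 1 t, ∑' v : Site d, if ω.Visits v 0 s then 1 else 0

/-- `V = lim V_t`, the total number of visits to the origin; the limit of the nondecreasing
sequence `V_t` is its supremum, possibly infinite. -/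
noncomputable def totalVisits : ℝ≥0∞ := ⨆ t : ℕ, ω.visitsUpTo t

end ParkingSpace

/-- `𝔼_p V`, as an element of `[0, ∞]`. -/
noncomputable def expectedVisits (d : ℕ) [NeZero d] (p : I) : ℝ≥0∞ :=
  ∫⁻ ω, ω.totalVisits ∂(parkingMeasure d p)

/-! By translation invariance, the expected number of visits to the origin at time `s + 1` is the
probability that the car from the origin is unparked at time `s`, so the expectation is the sum of
these probabilities (`expectedVisits_eq_tsum`). The term `s = 0` equals `p` and the term `s = 1` is
at least `p ^ 2`, which is the lower bound.

For the upper bound, a car unparked at time `t` forces a finite connected set `A`, containing its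
range, in which every site without an initial car was filled by a car from `A`
(`exists_stepConnected_filledFromWithin`). Hence more than half of the sites of `A` started with
cars (`FilledFromWithin.card_lt`). A connected set of `n` sites through the origin is the trace of a
path of `2 * (n - 1)` steps, so the number of such sets grows at most exponentially in `n`, while
each choice of cars costs `p ^ (n / 2 + 1)`.

To sum over time, note that the range has at most `n` sites only if no block of `n` steps is
straight; the probabilities of this sum over `t` to `n * (2 * d) ^ n`, again exponential. For `t ≥
1` the range has at least two sites, so `n ≥ 2`, and for small `p` the series is `O(p ^ 2)`,
stronger than the bound with the logarithm. -/

/-! ### Connected sets of sites and the paths covering them -/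

section Animals

variable {d : ℕ}

theorem stepVec_ne_zero (e : StepLabel d) : stepVec e ≠ 0 := by
  unfold stepVec
  rw [Ne, Pi.single_eq_zero_iff]
  split_ifs <;> decide

/-- The label of the opposite unit step. -/
def StepLabel.opp (e : StepLabel d) : StepLabel d := (e.1, !e.2)

theorem stepVec_opp (e : StepLabel d) : stepVec e.opp = -stepVec e := by
  obtain ⟨i, b⟩ := e
  cases b <;> simp [stepVec, StepLabel.opp, ← Pi.single_neg]

/-- The sites visited by the path from `x` with the given steps. -/
def trace : Site d → List (StepLabel d) → Finset (Site d)
  | x, [] => {x}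
  | x, e :: l => insert x (trace (x + stepVec e) l)

theorem start_mem_trace (x : Site d) (l : List (StepLabel d)) : x ∈ trace x l := by
  cases l <;> simp [trace]

/-- A path can be extended by an excursion to a neighbour of a visited site. -/
theorem exists_trace_insert {x y : Site d} {l : List (StepLabel d)} (hy : y ∈ trace x l)
    (e : StepLabel d) :
    ∃ l', l'.length = l.length + 2 ∧ trace x l' = insert (y + stepVec e) (trace x l) := by
  induction l generalizing x with
  | nil =>
    obtain rfl : y = x := by simpa [trace] using hy
    refine ⟨[e, e.opp], rfl, ?_⟩
    ext z
    simp [trace, stepVec_opp]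
  | cons f l ih =>
    by_cases h : y = x
    · subst h
      refine ⟨e :: e.opp :: f :: l, rfl, ?_⟩
      ext z
      simp [trace, stepVec_opp]
    · obtain ⟨l', hl, ht⟩ := ih (by simpa [trace, h] using hy)
      refine ⟨f :: l', by simp [hl], ?_⟩
      simp only [trace, ht]
      exact Finset.insert_comm _ _ _

/-- A finite set of sites such that each proper nonempty part of it is joined by a unit step to
the rest. -/
def StepConnected (A : Finset (Site d)) : Prop :=
  ∀ B ⊆ A, B.Nonempty → B ≠ A → ∃ b ∈ B, ∃ e : StepLabel d, b + stepVec e ∈ A \ B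

theorem stepConnected_singleton (x : Site d) : StepConnected {x} := by
  intro B hB hne hBA
  exact absurd ((Finset.subset_singleton_iff.1 hB).resolve_left hne.ne_empty) hBA

/-- A set `B` without an exit contains each of the two pieces that it meets. It meets one, so it
contains `z`, so it contains both. -/
theorem StepConnected.union {A₁ A₂ : Finset (Site d)} (h₁ : StepConnected A₁)
    (h₂ : StepConnected A₂) {z : Site d} (hz₁ : z ∈ A₁) (hz₂ : z ∈ A₂) :
    StepConnected (A₁ ∪ A₂) := by
  intro B hB hne hBA
  have key : ∀ A : Finset (Site d), StepConnected A → A ⊆ A₁ ∪ A₂ → (B ∩ A).Nonempty →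
      B ∩ A ≠ A → ∃ b ∈ B, ∃ e : StepLabel d, b + stepVec e ∈ (A₁ ∪ A₂) \ B := by
    intro A hA hsub hne hneq
    obtain ⟨b, hb, e, he⟩ := hA (B ∩ A) Finset.inter_subset_right hne hneq
    simp only [Finset.mem_sdiff, Finset.mem_inter, not_and] at he hb ⊢
    exact ⟨b, hb.1, e, hsub he.1, fun h => he.2 h he.1⟩
  by_contra hcon
  have k₁ := fun hn => by_contra fun hq =>
    hcon (key A₁ h₁ Finset.subset_union_left hn hq)
  have k₂ := fun hn => by_contra fun hq =>
    hcon (key A₂ h₂ Finset.subset_union_right hn hq)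
  simp only [Finset.inter_eq_right] at k₁ k₂
  have hzB : z ∈ B := by
    obtain ⟨b, hb⟩ := hne
    rcases Finset.mem_union.1 (hB hb) with hb' | hb'
    · exact k₁ ⟨b, Finset.mem_inter.2 ⟨hb, hb'⟩⟩ hz₁
    · exact k₂ ⟨b, Finset.mem_inter.2 ⟨hb, hb'⟩⟩ hz₂
  exact hBA (hB.antisymm (Finset.union_subset (k₁ ⟨z, Finset.mem_inter.2 ⟨hzB, hz₁⟩⟩)
    (k₂ ⟨z, Finset.mem_inter.2 ⟨hzB, hz₂⟩⟩)))

theorem stepConnected_pair (x : Site d) (e : StepLabel d) :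
    StepConnected {x, x + stepVec e} := by
  intro B hB hne hBA
  have hx : ∀ z ∈ B, z = x ∨ z = x + stepVec e := fun z hz => by simpa using hB hz
  by_cases h1 : x ∈ B
  · refine ⟨x, h1, e, ?_⟩
    simp only [Finset.mem_sdiff, Finset.mem_insert, Finset.mem_singleton, or_true, true_and]
    intro h2
    exact hBA (hB.antisymm (by simp [Finset.insert_subset_iff, h1, h2]))
  · obtain ⟨z, hz⟩ := hne
    rcases hx z hz with rfl | rfl
    · exact absurd hz h1
    · exact ⟨_, hz, e.opp, by simp [stepVec_opp, h1]⟩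

theorem StepConnected.insert {A : Finset (Site d)} (h : StepConnected A) {x : Site d}
    (hx : x ∈ A) (e : StepLabel d) : StepConnected (insert (x + stepVec e) A) := by
  have := h.union (stepConnected_pair x e) hx (by simp)
  convert this using 1
  ext z
  simp only [Finset.mem_insert, Finset.mem_union, Finset.mem_singleton]
  constructor
  · tauto
  · rintro (h | rfl | h) <;> tauto

/-- The path grows by one site at a time: connectedness supplies an unvisited neighbour, and an
excursion to it costs two steps. This turns the count of connected sets into a count of paths. -/
theorem StepConnected.exists_trace_eq {A : Finset (Site d)} (h : StepConnected A) {x : Site d}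
    (hx : x ∈ A) : ∃ l : List (StepLabel d), l.length = 2 * (A.card - 1) ∧ trace x l = A := by
  have key : ∀ k, k + 1 ≤ A.card → ∃ l : List (StepLabel d), l.length = 2 * k ∧
      trace x l ⊆ A ∧ (trace x l).card = k + 1 := by
    intro k
    induction k with
    | zero => exact fun _ => ⟨[], by simp [trace, hx]⟩
    | succ k ih =>
      intro hk
      obtain ⟨l, hl, hsub, hcard⟩ := ih (by omega)
      obtain ⟨b, hb, e, he⟩ := h _ hsub ⟨x, start_mem_trace x l⟩ (fun heq => by rw [heq] at hcard; omega)
      rw [Finset.mem_sdiff] at he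
      obtain ⟨l', hl', ht⟩ := exists_trace_insert hb e
      refine ⟨l', by omega, ?_, ?_⟩
      · rw [ht]
        exact Finset.insert_subset he.1 hsub
      · rw [ht, Finset.card_insert_of_notMem he.2, hcard]
  have hpos : 0 < A.card := Finset.card_pos.2 ⟨x, hx⟩
  obtain ⟨l, hl, hsub, hcard⟩ := key (A.card - 1) (by omega)
  exact ⟨l, hl, Finset.eq_of_subset_of_card_le hsub (by omega)⟩

end Animals

/-! ### Deterministic analysis of the parking dynamics -/

namespace ParkingSpace

variable {d : ℕ} {ω : ParkingSpace d}

@[simp] theorem walk_zero (v : Site d) : ω.walk v 0 = v := by simp [walk]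

theorem walk_succ (v : Site d) (t : ℕ) :
    ω.walk v (t + 1) = ω.walk v t + stepVec ((ω v).2.1 t) := by
  simp [walk, Finset.sum_range_succ, add_assoc]

theorem abs_stepVec_apply_le (e : StepLabel d) (i : Fin d) : |stepVec e i| ≤ 1 := by
  unfold stepVec
  by_cases h : i = e.1
  · subst h
    split_ifs <;> simp
  · simp [Pi.single_eq_of_ne h]

theorem abs_walk_sub_le (v : Site d) (t : ℕ) (i : Fin d) : |ω.walk v t i - v i| ≤ t := by
  induction t with
  | zero => simp
  | succ t ih =>
    have h := abs_stepVec_apply_le ((ω v).2.1 t) i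
    rw [walk_succ, Pi.add_apply]
    push_cast
    rw [abs_le] at *
    constructor <;> linarith

/-- Finiteness provides a largest tie-breaking variable at a contested spot for every `ω`, with no
exceptional null set. -/
theorem finite_walk_eq (x : Site d) (t : ℕ) : {v | ω.walk v t = x}.Finite := by
  refine (Set.finite_Icc (x - fun _ => (t : ℤ)) (x + fun _ => (t : ℤ))).subset ?_
  rintro v rfl
  constructor <;> intro i <;> have h := abs_walk_sub_le (ω := ω) v t i <;>
    rw [abs_le] at h <;> simp only [Pi.sub_apply, Pi.add_apply] <;> linarith

theorem unparked_antitone : Antitone fun t => (ω.state t).unparked :=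
  antitone_nat_of_succ_le fun _ _ h => h.1

theorem hasCar_of_unparked {t : ℕ} {v : Site d} (h : v ∈ (ω.state t).unparked) : ω.HasCar v :=
  unparked_antitone (Nat.zero_le t) h

/-- The car from `v` parks at `x` at some time at most `t`. -/
def ParksBy (ω : ParkingSpace d) (t : ℕ) (v x : Site d) : Prop :=
  ∃ s < t, ω.ParksAt (ω.state s) (s + 1) v ∧ ω.walk v (s + 1) = x

theorem ParksBy.mono {s t : ℕ} (hst : s ≤ t) {v x : Site d} (h : ω.ParksBy s v x) :
    ω.ParksBy t v x := by
  obtain ⟨r, hr, h⟩ := h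
  exact ⟨r, hr.trans_le hst, h⟩

theorem ParksBy.hasCar {t : ℕ} {v x : Site d} (h : ω.ParksBy t v x) : ω.HasCar v := by
  obtain ⟨r, hr, h, -⟩ := h
  exact hasCar_of_unparked h.1

theorem ParksBy.not_unparked {t : ℕ} {v x : Site d} (h : ω.ParksBy t v x) :
    v ∉ (ω.state t).unparked := by
  obtain ⟨r, hr, h, -⟩ := h
  exact fun hv => (unparked_antitone (Nat.succ_le_of_lt hr) hv).2 h

/-- A parked car is never unparked again, so it parks only once. This makes the assignment of cars
to filled spots injective. -/
theorem ParksBy.unique {s t : ℕ} {v x y : Site d} (h : ω.ParksBy s v x) (h' : ω.ParksBy t v y) :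
    x = y := by
  obtain ⟨a, ha, h, rfl⟩ := h
  obtain ⟨b, hb, h', rfl⟩ := h'
  rcases lt_trichotomy a b with hab | rfl | hab
  · exact absurd h'.1 (ParksBy.not_unparked ⟨a, hab, h, rfl⟩)
  · rfl
  · exact absurd h.1 (ParksBy.not_unparked ⟨b, hab, h', rfl⟩)

theorem hasCar_or_parksBy_of_not_vacant {t : ℕ} {x : Site d} (h : x ∉ (ω.state t).vacant) :
    ω.HasCar x ∨ ∃ v, ω.ParksBy t v x := by
  induction t with
  | zero => exact Or.inl (by simpa [state] using h)
  | succ t ih =>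
    by_cases hx : x ∈ (ω.state t).vacant
    · right
      by_contra hcon
      exact h ⟨hx, fun ⟨v, hv, hvx⟩ => hcon ⟨v, t, t.lt_succ_self, hv, hvx⟩⟩
    · exact (ih hx).imp_right fun ⟨v, hv⟩ => ⟨v, hv.mono t.le_succ⟩

/-- Some car parks at a vacant spot to which an unparked car moves. -/
theorem walk_not_vacant {t : ℕ} {v : Site d} (h : v ∈ (ω.state t).unparked) :
    ω.walk v (t + 1) ∉ (ω.state (t + 1)).vacant := by
  rintro ⟨hvac, hno⟩
  have hfin : {u | u ∈ (ω.state t).unparked ∧ ω.walk u (t + 1) = ω.walk v (t + 1)}.Finite :=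
    (finite_walk_eq (ω := ω) (ω.walk v (t + 1)) (t + 1)).subset fun u hu => hu.2
  obtain ⟨u, hu, hmax⟩ := Set.exists_max_image _ (fun u => ω.tieBreak u (t + 1)) hfin ⟨v, h, rfl⟩
  exact hno ⟨u, ⟨hu.1, hu.2 ▸ hvac, fun w hw hwu => hmax w ⟨hw, hwu.trans hu.2⟩⟩, hu.2⟩

/-- Every site of `A` is filled by time `t` by a car that starts in `A`. -/
def FilledFromWithin (ω : ParkingSpace d) (t : ℕ) (A : Finset (Site d)) : Prop :=
  ∀ x ∈ A, ω.HasCar x ∨ ∃ v ∈ A, ω.ParksBy t v x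

/-- Strong induction on time. After a move to a new site, that site is not vacant: either it began
with a car, or some car parked there. In the second case the set built for that car, at the time
just before it parked, is glued on at the new site. -/
theorem exists_stepConnected_filledFromWithin (t : ℕ) :
    ∀ v ∈ (ω.state t).unparked, ∃ A : Finset (Site d), StepConnected A ∧
      ω.FilledFromWithin t A ∧ ∀ s ≤ t, ω.walk v s ∈ A := by
  induction t using Nat.strong_induction_on with
  | _ t ih =>
  intro v hv
  rcases t with _ | t
  · refine ⟨{v}, stepConnected_singleton v, fun x hx => ?_, fun s hs => ?_⟩
    · obtain rfl := Finset.mem_singleton.1 hx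
      exact Or.inl hv
    · obtain rfl : s = 0 := by omega
      simp
  obtain ⟨A, hA, hfill, hmem⟩ := ih t t.lt_succ_self v hv.1
  have hcov : ∀ B : Finset (Site d), insert (ω.walk v (t + 1)) A ⊆ B →
      ∀ s ≤ t + 1, ω.walk v s ∈ B := by
    intro B hB s hs
    rcases Nat.le_succ_iff.1 hs with hs | rfl
    · exact hB (Finset.mem_insert_of_mem (hmem s hs))
    · exact hB (Finset.mem_insert_self _ _)
  have hA' : StepConnected (insert (ω.walk v (t + 1)) A) := by
    rw [walk_succ]
    exact hA.insert (hmem t le_rfl) _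
  rcases hasCar_or_parksBy_of_not_vacant (walk_not_vacant hv.1) with hcar | ⟨u, hu⟩
  · refine ⟨_, hA', fun x hx => ?_, hcov _ subset_rfl⟩
    rcases Finset.mem_insert.1 hx with rfl | hx
    · exact Or.inl hcar
    · exact (hfill x hx).imp_right fun ⟨w, hw, hwx⟩ =>
        ⟨w, Finset.mem_insert_of_mem hw, hwx.mono t.le_succ⟩
  -- The car `u` parked at time `s + 1 ≤ t + 1` and was unparked at time `s`, so the induction
  -- hypothesis applies to it. Its set contains its start, hence the new site is filled from within.
  · obtain ⟨s, hs, hpark, hux⟩ := id hu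
    obtain ⟨A₂, hA₂, hfill₂, hmem₂⟩ := ih s hs u hpark.1
    have hA₂' : StepConnected (insert (ω.walk v (t + 1)) A₂) := by
      rw [← hux, walk_succ]
      exact hA₂.insert (hmem₂ s le_rfl) _
    refine ⟨_, hA'.union hA₂' (Finset.mem_insert_self _ _) (Finset.mem_insert_self _ _),
      fun x hx => ?_, hcov _ Finset.subset_union_left⟩
    have hcase : x = ω.walk v (t + 1) ∨ x ∈ A ∨ x ∈ A₂ := by
      simp only [Finset.mem_union, Finset.mem_insert] at hx
      tauto
    rcases hcase with rfl | hx | hx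
    · have : u ∈ A₂ := by simpa using hmem₂ 0 (Nat.zero_le s)
      exact Or.inr ⟨u, by simp [this], hu⟩
    · exact (hfill x hx).imp_right fun ⟨w, hw, hwx⟩ => ⟨w, by simp [hw], hwx.mono t.le_succ⟩
    · exact (hfill₂ x hx).imp_right fun ⟨w, hw, hwx⟩ => ⟨w, by simp [hw], hwx.mono hs.le⟩

open Classical in
/-- If each site of `A` is filled by a car from within and the car from `v ∈ A` is still unparked,
then more than half of the sites of `A` have cars. -/
theorem FilledFromWithin.card_lt {t : ℕ} {A : Finset (Site d)} (h : ω.FilledFromWithin t A)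
    {v : Site d} (hv : v ∈ (ω.state t).unparked) (hvA : v ∈ A) :
    A.card < 2 * (A.filter ω.HasCar).card := by
  have hcar : v ∈ A.filter ω.HasCar := Finset.mem_filter.2 ⟨hvA, hasCar_of_unparked hv⟩
  have hch : ∀ x ∈ A.filter (¬ ω.HasCar ·), ∃ u ∈ A, ω.ParksBy t u x := fun x hx =>
    (h x (Finset.mem_filter.1 hx).1).resolve_left (Finset.mem_filter.1 hx).2
  choose! f hfA hf using hch
  -- The car that fills a site determines the site, and it is never `v`, which is still unparked.
  have hle : (A.filter (¬ ω.HasCar ·)).card ≤ ((A.filter ω.HasCar).erase v).card := by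
    refine Finset.card_le_card_of_injOn f (fun x hx => ?_) fun x hx y hy hxy => ?_
    · refine Finset.mem_coe.2 (Finset.mem_erase.2 ⟨?_, Finset.mem_filter.2
        ⟨hfA x hx, (hf x hx).hasCar⟩⟩)
      exact fun heq => (hf x hx).not_unparked (heq ▸ hv)
    · exact (hf x hx).unique (hxy ▸ hf y hy)
  rw [Finset.card_erase_of_mem hcar] at hle
  have hpos : 0 < (A.filter ω.HasCar).card := Finset.card_pos.2 ⟨v, hcar⟩
  have := Finset.card_filter_add_card_filter_not (s := A) ω.HasCar
  omega

end ParkingSpace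

/-- The sites visited through time `t` by the walk from the origin with the given steps. -/
def rangeUpTo {d : ℕ} (f : ℕ → StepLabel d) (t : ℕ) : Finset (Site d) :=
  (Finset.range (t + 1)).image fun s => ∑ r ∈ Finset.range s, stepVec (f r)

namespace ParkingSpace

variable {d : ℕ} {ω : ParkingSpace d}

theorem walk_origin (t : ℕ) : ω.walk 0 t = ∑ r ∈ Finset.range t, stepVec ((ω 0).2.1 r) := by
  simp [walk]

open Classical in
/-- A car unparked at time `t ≥ 1` is surrounded by a set of sites, covered by a short path and at
least as large as the range of the car, of which more than half have cars. -/
theorem exists_trace_of_unparked {t : ℕ} (ht : 1 ≤ t) (h : (0 : Site d) ∈ (ω.state t).unparked) :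
    ∃ m : ℕ, (rangeUpTo (ω 0).2.1 t).card ≤ m + 2 ∧
      ∃ l : List.Vector (StepLabel d) (2 * (m + 1)), ∃ S ∈ (trace 0 l.1).powerset,
        (trace (0 : Site d) l.1).card = m + 2 ∧ 0 ∈ S ∧ S.card = m / 2 + 2 ∧
          ∀ v ∈ S, ω.HasCar v := by
  obtain ⟨A, hA, hfill, hmem⟩ := exists_stepConnected_filledFromWithin t 0 h
  have h0 : (0 : Site d) ∈ A := by simpa using hmem 0 (Nat.zero_le t)
  have h1 := hmem 1 ht
  have hsub : rangeUpTo (ω 0).2.1 t ⊆ A := by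
    intro x hx
    obtain ⟨s, hs, rfl⟩ := Finset.mem_image.1 hx
    rw [← walk_origin]
    exact hmem s (by simpa [Nat.lt_succ_iff] using hs)
  have hcard : 2 ≤ A.card := by
    have h01 : (0 : Site d) ≠ ω.walk 0 1 := by
      rw [walk_succ, walk_zero, zero_add]
      exact (stepVec_ne_zero _).symm
    rw [← Finset.card_pair h01]
    exact Finset.card_le_card (by simp [Finset.insert_subset_iff, h0, h1])
  obtain ⟨l, hl, htr⟩ := hA.exists_trace_eq h0
  have hcars := hfill.card_lt h h0
  have hcar0 : (0 : Site d) ∈ A.filter ω.HasCar :=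
    Finset.mem_filter.2 ⟨h0, hasCar_of_unparked h⟩
  -- The size is the least integer above `A.card / 2`. The origin is kept in `S` so that its walk
  -- can be constrained together with the cars.
  obtain ⟨S, hS1, hS2, hS3⟩ := Finset.exists_subsuperset_card_eq
    (n := (A.card - 2) / 2 + 2) (Finset.singleton_subset_iff.2 hcar0)
    (by simp) (by omega)
  refine ⟨A.card - 2, (Finset.card_le_card hsub).trans (by omega), ⟨l, by omega⟩, S, ?_, ?_, ?_,
    hS3, fun v hv => (Finset.mem_filter.1 (hS2 hv)).2⟩
  · rw [htr, Finset.mem_powerset]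
    exact hS2.trans (Finset.filter_subset _ _)
  · rw [htr]
    omega
  · exact hS1 (Finset.mem_singleton_self _)

end ParkingSpace

/-! ### Straight blocks of a simple random walk -/

section Steps

/-- The law of the steps of a simple random walk. -/
noncomputable def stepLaw (d : ℕ) [NeZero d] : Measure (ℕ → StepLabel d) :=
  Measure.infinitePi fun _ : ℕ => (PMF.uniformOfFintype (StepLabel d)).toMeasure

instance (d : ℕ) [NeZero d] : IsProbabilityMeasure (stepLaw d) := by
  unfold stepLaw
  infer_instance

/-- None of the blocks of `n` consecutive steps completed through time `t` consists of the step
`e` only. -/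
def NoStraightBlock {d : ℕ} (e : StepLabel d) (n t : ℕ) (f : ℕ → StepLabel d) : Prop :=
  ∀ k < t / n, ∃ j < n, f (k * n + j) ≠ e

variable {d : ℕ}

theorem measurableSet_noStraightBlock (e : StepLabel d) (n t : ℕ) :
    MeasurableSet {f | NoStraightBlock e n t f} := by
  simp only [NoStraightBlock, Set.ofPred_forall, Set.ofPred_exists, ← exists_prop]
  refine .iInter fun k => .iInter fun _ => .iUnion fun j => .iUnion fun _ => ?_
  exact (measurableSet_eq_fun (measurable_pi_apply _) measurable_const).compl

/-- A straight block of `n` steps alone visits `n + 1` distinct sites. -/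
theorem noStraightBlock_of_card_le {e : StepLabel d} {n t : ℕ} {f : ℕ → StepLabel d}
    (h : (rangeUpTo f t).card ≤ n) : NoStraightBlock e n t f := by
  intro k hk
  by_contra! hcon
  have hsum : ∀ j ≤ n, ∑ r ∈ Finset.range (k * n + j), stepVec (f r) =
      ∑ r ∈ Finset.range (k * n), stepVec (f r) + j • stepVec e := by
    intro j hj
    rw [Finset.sum_range_add, Finset.sum_congr (rfl : Finset.range j = _) fun r hr =>
      congrArg stepVec (hcon r ((Finset.mem_range.1 hr).trans_le hj)), Finset.sum_const,
      Finset.card_range]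
  have hle : (Finset.range (n + 1)).card ≤ (rangeUpTo f t).card := by
    refine Finset.card_le_card_of_injOn
      (fun j => ∑ r ∈ Finset.range (k * n + j), stepVec (f r)) (fun j hj => ?_)
      fun i hi j hj hij => ?_
    · have hjn : j ≤ n := by simpa [Nat.lt_succ_iff] using hj
      have : (k + 1) * n ≤ t := (Nat.mul_le_mul_right n hk).trans (Nat.div_mul_le_self t n)
      refine Finset.mem_coe.2 (Finset.mem_image.2 ⟨k * n + j, ?_, rfl⟩)
      rw [Finset.mem_range]
      linarith
    · have hi' : i ≤ n := by simpa [Nat.lt_succ_iff] using hi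
      have hj' : j ≤ n := by simpa [Nat.lt_succ_iff] using hj
      simp only [hsum i hi', hsum j hj', add_right_inj] at hij
      have := congrFun hij e.1
      rcases e with ⟨a, b⟩
      cases b <;> simpa [stepVec] using this
  simp at hle
  omega

variable [NeZero d]

theorem uniform_singleton (e : StepLabel d) :
    (PMF.uniformOfFintype (StepLabel d)).toMeasure {e} = (2 * d : ℝ≥0∞)⁻¹ := by
  rw [PMF.toMeasure_apply_singleton _ _ (measurableSet_singleton _), PMF.uniformOfFintype_apply]
  simp [mul_comm]

theorem stepLaw_noStraightBlock (e : StepLabel d) {n : ℕ} (hn : 0 < n) (t : ℕ) :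
    stepLaw d {f | NoStraightBlock e n t f} = (1 - (2 * d : ℝ≥0∞)⁻¹ ^ n) ^ (t / n) := by
  set u := (PMF.uniformOfFintype (StepLabel d)).toMeasure with hu
  have hinj : Function.Injective fun q : ℕ × Fin n => q.1 * n + q.2.1 := by
    rintro ⟨a, b, hb⟩ ⟨a', b', hb'⟩ h
    simp only at h
    have h1 : a = a' := by
      have := congrArg (· / n) h
      simpa [Nat.add_div_of_dvd_right, Nat.mul_div_cancel _ hn, Nat.div_eq_of_lt hb,
        Nat.div_eq_of_lt hb'] using this
    subst h1
    simpa using h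
  -- Cutting the steps into disjoint blocks gives i.i.d. blocks.
  have hmap : (stepLaw d).map (fun f (k : ℕ) (j : Fin n) => f (k * n + j.1)) =
      Measure.infinitePi fun _ : ℕ => Measure.infinitePi fun _ : Fin n => u := by
    rw [← Measure.infinitePi_map_curry (fun (_ : ℕ) (_ : Fin n) => u),
      ← Measure.map_infinitePi_infinitePi_of_inj (P := fun _ : ℕ => u) hinj,
      Measure.map_map (by fun_prop) (by fun_prop)]
    rfl
  have hmeas : MeasurableSet ({fun _ => e}ᶜ : Set (Fin n → StepLabel d)) :=
    (measurableSet_singleton _).compl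
  have hset : {f | NoStraightBlock e n t f} =
      (fun f (k : ℕ) (j : Fin n) => f (k * n + j.1)) ⁻¹'
        Set.pi (Finset.range (t / n) : Set ℕ) fun _ => {fun _ => e}ᶜ := by
    ext f
    simp [NoStraightBlock, Set.mem_pi, funext_iff, Fin.exists_iff]
  rw [hset, ← Measure.map_apply (by fun_prop)
    (.pi (Finset.countable_toSet _) fun _ _ => hmeas), hmap,
    Measure.infinitePi_pi _ fun _ _ => hmeas]
  rw [Finset.prod_const, Finset.card_range, prob_compl_eq_one_sub (measurableSet_singleton _),
    Measure.infinitePi_singleton_of_fintype]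
  simp_rw [hu, uniform_singleton, Finset.prod_const, Finset.card_univ, Fintype.card_fin]

/-- Each value of `t / n` is taken by `n` times `t`, so the sum is `n` copies of a geometric series.
-/
theorem tsum_stepLaw_noStraightBlock (e : StepLabel d) {n : ℕ} (hn : 0 < n) :
    ∑' t, stepLaw d {f | NoStraightBlock e n t f} = n * (2 * d : ℝ≥0∞) ^ n := by
  have : NeZero n := ⟨hn.ne'⟩
  simp_rw [stepLaw_noStraightBlock e hn]
  rw [← (Nat.divModEquiv n).symm.tsum_eq, ENNReal.tsum_prod
    (f := fun k j => (1 - (2 * d : ℝ≥0∞)⁻¹ ^ n) ^ ((Nat.divModEquiv n).symm (k, j) / n))]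
  -- Subtraction truncates in `ℝ≥0∞`; this bound makes `1 - (1 - x) = x`.
  have hx : (2 * d : ℝ≥0∞)⁻¹ ^ n ≤ 1 := by
    refine pow_le_one₀ zero_le ?_
    rw [ENNReal.inv_le_one]
    exact_mod_cast Nat.mul_pos two_pos (NeZero.pos d)
  have hdiv : ∀ (k : ℕ) (j : Fin n), (Nat.divModEquiv n).symm (k, j) / n = k := by
    intro k j
    exact congrArg Prod.fst ((Nat.divModEquiv n).apply_symm_apply (k, j))
  simp only [hdiv, tsum_fintype, Finset.sum_const, Finset.card_univ, Fintype.card_fin,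
    nsmul_eq_mul]
  rw [ENNReal.tsum_mul_left, ENNReal.tsum_geometric,
    ENNReal.sub_sub_cancel ENNReal.one_ne_top hx, ENNReal.inv_pow, inv_inv]

end Steps

/-! ### Probabilities of cylinder events -/

section Boxes

variable {d : ℕ} [NeZero d]

theorem siteLaw_car_steps (p : I) {B : Set (ℕ → StepLabel d)} :
    siteLaw d p {a | a.1 = true ∧ a.2.1 ∈ B} = ENNReal.ofReal p * stepLaw d B := by
  have : {a : SiteData d | a.1 = true ∧ a.2.1 ∈ B} = {true} ×ˢ (B ×ˢ Set.univ) := by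
    ext ⟨a, b, c⟩
    simp
  rw [this, siteLaw, Measure.prod_prod, Measure.prod_prod,
    bernoulliMeasure_apply_of_mem_of_notMem _ (measurableSet_singleton _) (by simp) (by simp),
    measure_univ, mul_one, stepLaw]
  congr 1
  rw [ENNReal.ofReal, ENNReal.coe_inj]
  ext
  simp [p.2.1]

theorem parkingMeasure_cars_steps (p : I) {S : Finset (Site d)} {w : Site d} (hw : w ∈ S)
    {B : Set (ℕ → StepLabel d)} (hB : MeasurableSet B) :
    parkingMeasure d p {ω | (∀ v ∈ S, ω.HasCar v) ∧ (ω w).2.1 ∈ B} =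
      ENNReal.ofReal p ^ S.card * stepLaw d B := by
  classical
  have hset : {ω : ParkingSpace d | (∀ v ∈ S, ω.HasCar v) ∧ (ω w).2.1 ∈ B} =
      Set.pi (S : Set (Site d)) fun v =>
        {a | a.1 = true ∧ a.2.1 ∈ if v = w then B else Set.univ} := by
    ext ω
    simp only [Set.mem_ofPred_eq, Set.mem_pi, Finset.mem_coe, ParkingSpace.HasCar]
    constructor
    · rintro ⟨h1, h2⟩ v hv
      refine ⟨h1 v hv, ?_⟩
      split_ifs with h
      · exact h ▸ h2
      · trivial
    · intro h
      exact ⟨fun v hv => (h v hv).1, by simpa using (h w hw).2⟩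
  rw [hset, parkingMeasure, Measure.infinitePi_pi]
  · simp_rw [siteLaw_car_steps]
    rw [Finset.prod_mul_distrib, Finset.prod_const, Finset.prod_eq_single_of_mem w hw]
    · simp
    · intro v _ hv
      simp [hv]
  · intro v _
    have hB' : MeasurableSet (if v = w then B else Set.univ) := by
      split_ifs
      exacts [hB, .univ]
    exact (measurableSet_eq_fun measurable_fst measurable_const).inter
      ((measurable_fst.comp measurable_snd) hB')

end Boxes

/-! ### Measurability and translation invariance -/

namespace ParkingSpace

section Measurability

variable {d : ℕ}

theorem measurable_walk (v : Site d) (t : ℕ) :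
    Measurable fun ω : ParkingSpace d => ω.walk v t := by
  unfold walk
  refine measurable_const.add (Finset.measurable_sum _ fun s _ => ?_)
  exact (measurable_of_countable stepVec).comp (by fun_prop)

theorem measurableSet_hasCar (v : Site d) : MeasurableSet {ω : ParkingSpace d | ω.HasCar v} :=
  measurableSet_eq_fun (f := fun ω : ParkingSpace d => (ω v).1) (by fun_prop) measurable_const

theorem measurableSet_walk_eq_walk (u v : Site d) (t : ℕ) :
    MeasurableSet {ω : ParkingSpace d | ω.walk u t = ω.walk v t} :=
  measurableSet_eq_fun (measurable_walk u t) (measurable_walk v t)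

theorem measurableSet_walk_eq (v x : Site d) (t : ℕ) :
    MeasurableSet {ω : ParkingSpace d | ω.walk v t = x} :=
  measurableSet_eq_fun (measurable_walk v t) measurable_const

theorem measurableSet_parksAt {t r : ℕ}
    (h₁ : ∀ v : Site d, MeasurableSet {ω : ParkingSpace d | v ∈ (ω.state t).unparked})
    (h₂ : ∀ x : Site d, MeasurableSet {ω : ParkingSpace d | x ∈ (ω.state t).vacant})
    (v : Site d) : MeasurableSet {ω : ParkingSpace d | ω.ParksAt (ω.state t) r v} := by
  refine (h₁ v).inter (.inter ?_ ?_)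
  · have : {ω : ParkingSpace d | ω.walk v r ∈ (ω.state t).vacant} =
        ⋃ x, {ω | ω.walk v r = x} ∩ {ω | x ∈ (ω.state t).vacant} := by
      ext ω
      simp
    change MeasurableSet {ω : ParkingSpace d | ω.walk v r ∈ (ω.state t).vacant}
    rw [this]
    exact .iUnion fun x => (measurableSet_walk_eq v x r).inter (h₂ x)
  · change MeasurableSet {ω : ParkingSpace d | ∀ u ∈ (ω.state t).unparked,
      ω.walk u r = ω.walk v r → ω.tieBreak u r ≤ ω.tieBreak v r}
    simp only [Set.ofPred_forall]
    refine .iInter fun u => ?_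
    exact measurableSet_setOfPred.2 ((measurableSet_setOfPred.1 (h₁ u)).imp
      ((measurableSet_setOfPred.1 (measurableSet_walk_eq_walk u v r)).imp
        (measurableSet_setOfPred.1 (measurableSet_le (by unfold tieBreak; fun_prop)
          (by unfold tieBreak; fun_prop)))))

theorem measurableSet_unparked_and_vacant (t : ℕ) :
    (∀ v : Site d, MeasurableSet {ω : ParkingSpace d | v ∈ (ω.state t).unparked}) ∧
      ∀ x : Site d, MeasurableSet {ω : ParkingSpace d | x ∈ (ω.state t).vacant} := by
  induction t with
  | zero => exact ⟨measurableSet_hasCar, fun x => (measurableSet_hasCar x).compl⟩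
  | succ t ih =>
    have hp := fun v => measurableSet_parksAt (r := t + 1) ih.1 ih.2 v
    refine ⟨fun v => (ih.1 v).inter (hp v).compl, fun x => (ih.2 x).inter (.compl ?_)⟩
    change MeasurableSet {ω : ParkingSpace d |
      ∃ v, ω.ParksAt (ω.state t) (t + 1) v ∧ ω.walk v (t + 1) = x}
    rw [Set.ofPred_exists]
    exact .iUnion fun v => (hp v).inter (measurableSet_walk_eq v x (t + 1))

theorem measurableSet_unparked (t : ℕ) (v : Site d) :
    MeasurableSet {ω : ParkingSpace d | v ∈ (ω.state t).unparked} :=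
  (measurableSet_unparked_and_vacant t).1 v

theorem measurableSet_visits (v x : Site d) (t : ℕ) :
    MeasurableSet {ω : ParkingSpace d | ω.Visits v x t} :=
  .inter (.const _) ((measurableSet_unparked (t - 1) v).inter (measurableSet_walk_eq v x t))

end Measurability

section Shift

variable {d : ℕ}

/-- The environment seen from the site `a`. -/
def shift (a : Site d) (ω : ParkingSpace d) : ParkingSpace d := fun v => ω (v + a)

theorem shift_walk (a : Site d) (ω : ParkingSpace d) (v : Site d) (t : ℕ) :
    (shift a ω).walk v t + a = ω.walk (v + a) t := by
  simp only [walk, shift]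
  abel

theorem shift_parksAt {a : Site d} {ω : ParkingSpace d} {S S' : ParkingState d} {t : ℕ}
    (h₁ : ∀ v, v ∈ S'.unparked ↔ v + a ∈ S.unparked)
    (h₂ : ∀ v, v ∈ S'.vacant ↔ v + a ∈ S.vacant) (v : Site d) :
    (shift a ω).ParksAt S' t v ↔ ω.ParksAt S t (v + a) := by
  unfold ParksAt
  rw [h₁, h₂, shift_walk]
  refine and_congr_right fun _ => and_congr_right fun _ => ?_
  rw [← (Equiv.addRight a).forall_congr_right (q := fun u => u ∈ S.unparked →
    ω.walk u t = ω.walk (v + a) t → ω.tieBreak u t ≤ ω.tieBreak (v + a) t)]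
  refine forall_congr' fun u => ?_
  rw [h₁, ← add_left_inj a, shift_walk, shift_walk]
  rfl

theorem shift_state (a : Site d) (ω : ParkingSpace d) (t : ℕ) :
    (∀ v, v ∈ ((shift a ω).state t).unparked ↔ v + a ∈ (ω.state t).unparked) ∧
      ∀ v, v ∈ ((shift a ω).state t).vacant ↔ v + a ∈ (ω.state t).vacant := by
  induction t with
  | zero => exact ⟨fun v => Iff.rfl, fun v => Iff.rfl⟩
  | succ t ih =>
    have hp := fun v => shift_parksAt (ω := ω) (t := t + 1) ih.1 ih.2 v
    refine ⟨fun v => and_congr (ih.1 v) (not_congr (hp v)),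
      fun v => and_congr (ih.2 v) (not_congr ?_)⟩
    rw [← (Equiv.addRight a).exists_congr_right (q := fun u =>
      ω.ParksAt (ω.state t) (t + 1) u ∧ ω.walk u (t + 1) = v + a)]
    refine exists_congr fun u => and_congr (hp u) ?_
    rw [← add_left_inj a, shift_walk]
    rfl

variable [NeZero d]

theorem measurePreserving_shift (p : I) (a : Site d) :
    MeasurePreserving (shift a) (parkingMeasure d p) (parkingMeasure d p) :=
  ⟨measurable_pi_lambda _ fun _ => measurable_pi_apply _,
    Measure.map_infinitePi_infinitePi_of_inj (P := fun _ : Site d => siteLaw d p)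
      (add_left_injective a)⟩

/-- By translation invariance, the expected number of visits to the origin at a given time is the
probability that the car from the origin is unparked just before. -/
theorem tsum_measure_visits (p : I) (s : ℕ) :
    ∑' v : Site d, parkingMeasure d p {ω | ω.Visits v 0 (s + 1)} =
      parkingMeasure d p {ω | (0 : Site d) ∈ (ω.state s).unparked} := by
  -- Seen from `v`, the car from `v` starts at the origin, and the origin becomes `-v`.
  have h : ∀ v : Site d, parkingMeasure d p {ω | ω.Visits v 0 (s + 1)} =
      parkingMeasure d p {ω | (0 : Site d) ∈ (ω.state s).unparked ∧ ω.walk 0 (s + 1) = -v} := by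
    intro v
    refine Eq.trans ?_ ((measurePreserving_shift p v).measure_preimage
      ((measurableSet_unparked s 0).inter
        (measurableSet_walk_eq 0 (-v) (s + 1))).nullMeasurableSet)
    congr 1
    ext ω
    have := shift_walk v ω 0 (s + 1)
    have h2 := (shift_state v ω s).1 0
    rw [zero_add] at this h2
    simp only [Visits, Set.mem_ofPred_eq, Set.mem_preimage, h2, ← this,
      Nat.add_sub_cancel, eq_neg_iff_add_eq_zero]
    simp
  simp_rw [h]
  refine ((Equiv.neg (Site d)).tsum_eq (fun v => parkingMeasure d p
    {ω | (0 : Site d) ∈ (ω.state s).unparked ∧ ω.walk 0 (s + 1) = v})).trans ?_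
  rw [← measure_iUnion]
  · congr 1
    ext ω
    simp
  · intro u v huv
    refine Set.disjoint_left.2 fun ω h1 h2 => huv (h1.2.symm.trans h2.2)
  · exact fun v => (measurableSet_unparked s 0).inter (measurableSet_walk_eq 0 v (s + 1))

theorem lintegral_visitsUpTo (p : I) (t : ℕ) :
    ∫⁻ ω, visitsUpTo ω t ∂(parkingMeasure d p) =
      ∑ s ∈ Finset.range t,
        parkingMeasure d p {ω | (0 : Site d) ∈ (ω.state s).unparked} := by
  classical
  have hite : ∀ (v : Site d) (s : ℕ), (fun ω : ParkingSpace d =>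
      if ω.Visits v 0 s then (1 : ℝ≥0∞) else 0) = Set.indicator {ω | ω.Visits v 0 s} 1 := by
    intro v s
    ext ω
    simp [Set.indicator_apply]
  have hm : ∀ (v : Site d) (s : ℕ), Measurable (fun ω : ParkingSpace d =>
      if ω.Visits v 0 s then (1 : ℝ≥0∞) else 0) := fun v s =>
    Measurable.ite (measurableSet_visits v 0 s) measurable_const measurable_const
  simp only [visitsUpTo]
  rw [lintegral_finsetSum _ fun s _ => .tsum fun v => hm v s, ← Finset.Ico_succ_right_eq_Icc,
    Order.succ_eq_add_one, ← zero_add 1, ← Finset.sum_Ico_add', ← Finset.range_eq_Ico]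
  refine Finset.sum_congr rfl fun s _ => ?_
  rw [← tsum_measure_visits, lintegral_tsum fun v => (hm v _).aemeasurable]
  refine tsum_congr fun v => ?_
  rw [hite, lintegral_indicator_one (measurableSet_visits v 0 _)]

end Shift
end ParkingSpace

/-! ### The expected number of visits and its bounds -/

namespace ParkingSpace

variable {d : ℕ}

theorem visitsUpTo_mono (ω : ParkingSpace d) : Monotone ω.visitsUpTo := fun _ _ h =>
  Finset.sum_le_sum_of_subset (Finset.Icc_subset_Icc_right h)

theorem measurable_visitsUpTo (t : ℕ) : Measurable fun ω : ParkingSpace d => ω.visitsUpTo t :=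
  Finset.measurable_sum _ fun s _ => .tsum fun v =>
    Measurable.ite (measurableSet_visits v 0 s) measurable_const measurable_const

end ParkingSpace

open ParkingSpace

section Expectation

variable {d : ℕ} [NeZero d]

theorem expectedVisits_eq_tsum (p : I) :
    expectedVisits d p =
      ∑' s, parkingMeasure d p {ω | (0 : Site d) ∈ (ω.state s).unparked} := by
  simp only [expectedVisits, totalVisits]
  rw [lintegral_iSup measurable_visitsUpTo fun _ _ h ω => visitsUpTo_mono ω h,
    ENNReal.tsum_eq_iSup_nat]
  simp_rw [lintegral_visitsUpTo]

theorem measure_unparked_zero (p : I) :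
    parkingMeasure d p {ω | (0 : Site d) ∈ (ω.state 0).unparked} = ENNReal.ofReal p := by
  have := parkingMeasure_cars_steps (d := d) p (Finset.mem_singleton_self 0) (B := Set.univ) .univ
  simp only [Finset.mem_singleton, forall_eq, Set.mem_univ, and_true, Finset.card_singleton,
    pow_one, measure_univ, mul_one] at this
  exact this

/-- The car from the origin keeps walking at time `1` if it moves to a site with a car. -/
theorem sq_le_measure_unparked_one (p : I) :
    ENNReal.ofReal p ^ 2 ≤
      parkingMeasure d p {ω | (0 : Site d) ∈ (ω.state 1).unparked} := by
  have hB : ∀ e : StepLabel d, MeasurableSet {f : ℕ → StepLabel d | f 0 = e} := fun e =>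
    measurableSet_eq_fun (measurable_pi_apply 0) measurable_const
  have hE : ∀ e : StepLabel d, MeasurableSet {ω : ParkingSpace d |
      (∀ v ∈ ({0, stepVec e} : Finset (Site d)), ω.HasCar v) ∧ (ω 0).2.1 ∈ {f | f 0 = e}} := by
    intro e
    refine .inter ?_ ((hB e).preimage (by fun_prop))
    change MeasurableSet {ω : ParkingSpace d |
      ∀ v ∈ ({0, stepVec e} : Finset (Site d)), ω.HasCar v}
    simp only [Set.ofPred_forall]
    exact .iInter fun v => .iInter fun _ => measurableSet_hasCar v
  have hlaw : ∑ e : StepLabel d, stepLaw d {f | f 0 = e} = 1 := by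
    rw [← measure_biUnion_finset (fun e _ e' _ h => Set.disjoint_left.2 fun f h1 h2 =>
      h (h1.symm.trans h2)) fun e _ => hB e, ← measure_univ (μ := stepLaw d)]
    congr 1
    ext f
    simp
  calc ENNReal.ofReal p ^ 2
      = ∑ e : StepLabel d, ENNReal.ofReal p ^ 2 * stepLaw d {f | f 0 = e} := by
        rw [← Finset.mul_sum, hlaw, mul_one]
    _ = ∑ e : StepLabel d, parkingMeasure d p {ω : ParkingSpace d |
          (∀ v ∈ ({0, stepVec e} : Finset (Site d)), ω.HasCar v) ∧
            (ω 0).2.1 ∈ {f | f 0 = e}} := by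
        refine Finset.sum_congr rfl fun e _ => ?_
        rw [parkingMeasure_cars_steps p (by simp) (hB e),
          Finset.card_pair (stepVec_ne_zero e).symm]
    _ = parkingMeasure d p (⋃ e ∈ Finset.univ, {ω : ParkingSpace d |
          (∀ v ∈ ({0, stepVec e} : Finset (Site d)), ω.HasCar v) ∧
            (ω 0).2.1 ∈ {f | f 0 = e}}) :=
        (measure_biUnion_finset (fun e _ e' _ h => Set.disjoint_left.2 fun f h1 h2 =>
          h (h1.2.symm.trans h2.2)) fun e _ => hE e).symm
    _ ≤ _ := by
        refine measure_mono (Set.iUnion₂_subset fun e _ ω hω => ?_)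
        obtain ⟨hcars, he⟩ := hω
        have hwalk : ω.walk 0 1 = stepVec e := by
          rw [walk_succ, walk_zero, zero_add]
          exact congrArg stepVec he
        refine ⟨hcars 0 (by simp), fun hp => ?_⟩
        have hvac : ¬ ω.HasCar (ω.walk 0 1) := hp.2.1
        exact hvac (hwalk ▸ hcars (stepVec e) (by simp))

theorem le_expectedVisits (p : I) :
    ENNReal.ofReal ((p : ℝ) + (p : ℝ) ^ 2) ≤ expectedVisits d p := by
  rw [expectedVisits_eq_tsum, ENNReal.ofReal_add p.2.1 (sq_nonneg _), ENNReal.ofReal_pow p.2.1,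
    ← measure_unparked_zero (d := d)]
  refine le_trans ?_ (ENNReal.sum_le_tsum (Finset.range 2))
  rw [Finset.sum_range_succ, Finset.sum_range_one]
  refine add_le_add le_rfl ?_
  rw [measure_unparked_zero]
  exact sq_le_measure_unparked_one p

/-- Union bound over the size `m + 2`, the covering path and the set of cars `S`. Car placement and
steps are independent, so each event has a product probability. -/
theorem measure_unparked_le (p : I) (t : ℕ) :
    parkingMeasure d p {ω | (0 : Site d) ∈ (ω.state (t + 1)).unparked} ≤
      ∑' m : ℕ, (2 * d : ℝ≥0∞) ^ (2 * (m + 1)) * (2 ^ (m + 2) * (ENNReal.ofReal p ^ (m / 2 + 2) *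
        stepLaw d {f | NoStraightBlock (0, true) (m + 2) (t + 1) f})) := by
  classical
  have hsub : {ω : ParkingSpace d | (0 : Site d) ∈ (ω.state (t + 1)).unparked} ⊆
      ⋃ m : ℕ, ⋃ l : List.Vector (StepLabel d) (2 * (m + 1)),
        ⋃ S ∈ (trace 0 l.1).powerset.filter fun S =>
            (trace (0 : Site d) l.1).card = m + 2 ∧ 0 ∈ S ∧ S.card = m / 2 + 2,
          {ω | (∀ v ∈ S, ω.HasCar v) ∧
            (ω 0).2.1 ∈ {f | NoStraightBlock (0, true) (m + 2) (t + 1) f}} := by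
    intro ω hω
    obtain ⟨m, hm, l, S, hS, hl, h0, hcard, hcars⟩ := exists_trace_of_unparked
      (Nat.le_add_left 1 t) (Set.mem_ofPred_eq.mp hω)
    simp only [Set.mem_iUnion]
    exact ⟨m, l, S, Finset.mem_filter.2 ⟨hS, hl, h0, hcard⟩, hcars, noStraightBlock_of_card_le hm⟩
  refine (measure_mono hsub).trans ((measure_iUnion_le _).trans (ENNReal.tsum_le_tsum fun m => ?_))
  refine (measure_iUnion_fintype_le _ _).trans ?_
  have hl : ∀ l : List.Vector (StepLabel d) (2 * (m + 1)), parkingMeasure d p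
      (⋃ S ∈ (trace 0 l.1).powerset.filter fun S =>
            (trace (0 : Site d) l.1).card = m + 2 ∧ 0 ∈ S ∧ S.card = m / 2 + 2,
          {ω | (∀ v ∈ S, ω.HasCar v) ∧
            (ω 0).2.1 ∈ {f | NoStraightBlock (0, true) (m + 2) (t + 1) f}}) ≤
      2 ^ (m + 2) * (ENNReal.ofReal p ^ (m / 2 + 2) *
        stepLaw d {f | NoStraightBlock (0, true) (m + 2) (t + 1) f}) := by
    intro l
    refine (measure_biUnion_finset_le _ _).trans ?_
    by_cases hcard : (trace (0 : Site d) l.1).card = m + 2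
    · refine (Finset.sum_le_card_nsmul _ _ (ENNReal.ofReal p ^ (m / 2 + 2) *
        stepLaw d {f | NoStraightBlock (0, true) (m + 2) (t + 1) f}) fun S hS => ?_).trans ?_
      · obtain ⟨-, -, h0, hS⟩ := Finset.mem_filter.1 hS
        rw [parkingMeasure_cars_steps p h0 (measurableSet_noStraightBlock _ _ _), hS]
      · rw [nsmul_eq_mul]
        refine mul_le_mul_left ?_ _
        have := (Finset.card_filter_le (trace (0 : Site d) l.1).powerset fun S =>
          (trace (0 : Site d) l.1).card = m + 2 ∧ 0 ∈ S ∧ S.card = m / 2 + 2)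
        rw [Finset.card_powerset] at this
        replace this := this.trans_eq (congrArg (2 ^ ·) hcard)
        exact_mod_cast this
    · simp [hcard]
  refine (Finset.sum_le_sum fun l _ => hl l).trans (le_of_eq ?_)
  rw [Finset.sum_const, Finset.card_univ, card_vector, nsmul_eq_mul]
  simp [mul_comm]

/-- The coefficients in the bound for the expected number of visits. -/
noncomputable def visitSeries (d : ℕ) (q : ℝ≥0∞) : ℝ≥0∞ :=
  ∑' m : ℕ, (4 * (2 * d) ^ 3 : ℝ≥0∞) ^ (m + 2) * q ^ (m / 2)

theorem visitSeries_mono (d : ℕ) : Monotone (visitSeries d) := fun _ _ h =>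
  ENNReal.tsum_le_tsum fun _ => mul_le_mul_right (pow_le_pow_left₀ zero_le h _) _

theorem expectedVisits_le (p : I) :
    expectedVisits d p ≤
      ENNReal.ofReal p + ENNReal.ofReal p ^ 2 * visitSeries d (ENNReal.ofReal p) := by
  rw [expectedVisits_eq_tsum, tsum_eq_zero_add' ENNReal.summable, measure_unparked_zero]
  refine add_le_add le_rfl ((ENNReal.tsum_le_tsum fun t => measure_unparked_le p t).trans ?_)
  rw [ENNReal.tsum_comm, visitSeries, ← ENNReal.tsum_mul_left]
  refine ENNReal.tsum_le_tsum fun m => ?_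
  simp_rw [ENNReal.tsum_mul_left]
  -- The factor `m + 2` is absorbed into `2 ^ (m + 2)`.
  have hstep : ∑' t, stepLaw d {f | NoStraightBlock (0, true) (m + 2) (t + 1) f} ≤
      2 ^ (m + 2) * (2 * d : ℝ≥0∞) ^ (m + 2) := by
    refine (ENNReal.tsum_comp_le_tsum_of_injective (add_left_injective 1)
      fun t => stepLaw d {f | NoStraightBlock (0, true) (m + 2) t f}).trans ?_
    rw [tsum_stepLaw_noStraightBlock _ (by omega)]
    refine mul_le_mul_left ?_ _
    exact_mod_cast (Nat.lt_two_pow_self (n := m + 2)).le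
  have hd : (1 : ℝ≥0∞) ≤ 2 * d := by exact_mod_cast Nat.mul_pos two_pos (NeZero.pos d)
  calc _ ≤ (2 * d : ℝ≥0∞) ^ (2 * (m + 2)) * (2 ^ (m + 2) * (ENNReal.ofReal p ^ (m / 2 + 2) *
        (2 ^ (m + 2) * (2 * d : ℝ≥0∞) ^ (m + 2)))) := by
        exact mul_le_mul' (pow_le_pow_right₀ hd (by omega)) (by gcongr)
    _ = _ := by
        rw [show (4 : ℝ≥0∞) = 2 * 2 by norm_num]
        generalize (2 * d : ℝ≥0∞) = x
        generalize (2 : ℝ≥0∞) = y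
        ring

theorem exists_visitSeries_lt_top (d : ℕ) [NeZero d] :
    ∃ q : ℝ, 0 < q ∧ visitSeries d (ENNReal.ofReal q) < ∞ := by
  set K : ℝ := 4 * (2 * d) ^ 3 with hK
  have hd : (1 : ℝ) ≤ d := by exact_mod_cast NeZero.one_le
  have hK1 : 1 ≤ K := by
    have : (1 : ℝ) ≤ (2 * d) ^ 3 := one_le_pow₀ (by linarith)
    linarith
  have hK0 : 0 < K := by linarith
  -- The square offsets the exponent `m / 2`, leaving ratio `1 / 2`; rounding in `m / 2` costs at
  -- most one factor `2 * K`.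
  refine ⟨((2 * K)⁻¹) ^ 2, by positivity, ?_⟩
  have hKE : (4 * (2 * d) ^ 3 : ℝ≥0∞) = ENNReal.ofReal K := by
    rw [hK, ENNReal.ofReal_mul (by norm_num), ENNReal.ofReal_pow (by positivity),
      ENNReal.ofReal_mul (by norm_num)]
    simp
  rw [visitSeries, hKE]
  clear_value K
  have hterm : ∀ m : ℕ, ENNReal.ofReal K ^ (m + 2) *
      ENNReal.ofReal ((2 * K)⁻¹ ^ 2) ^ (m / 2) ≤ ENNReal.ofReal (K ^ 2 * (2 * K) * (1 / 2) ^ m) := by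
    intro m
    rw [← ENNReal.ofReal_pow hK0.le, ← ENNReal.ofReal_pow (by positivity),
      ← ENNReal.ofReal_mul (by positivity)]
    refine ENNReal.ofReal_le_ofReal ?_
    have h1 : ((2 * K)⁻¹ ^ 2) ^ (m / 2) * (2 * K)⁻¹ ≤ (2 * K)⁻¹ ^ m := by
      rw [← pow_mul, ← pow_succ]
      exact pow_le_pow_of_le_one (by positivity) (inv_le_one_of_one_le₀ (by linarith)) (by omega)
    have h2 : ((2 * K)⁻¹ ^ 2) ^ (m / 2) ≤ (2 * K) * (2 * K)⁻¹ ^ m := by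
      rw [← div_eq_mul_inv, div_le_iff₀ (by positivity)] at h1
      linarith
    calc K ^ (m + 2) * ((2 * K)⁻¹ ^ 2) ^ (m / 2)
        ≤ K ^ (m + 2) * ((2 * K) * (2 * K)⁻¹ ^ m) := by gcongr
      _ = K ^ 2 * (2 * K) * (K * (2 * K)⁻¹) ^ m := by rw [mul_pow]; ring
      _ = K ^ 2 * (2 * K) * (1 / 2) ^ m := by
        congr 2
        field_simp
  refine (ENNReal.tsum_le_tsum hterm).trans_lt ?_
  rw [← ENNReal.ofReal_tsum_of_nonneg (fun m => by positivity)
    (summable_geometric_two.mul_left _)]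
  exact ENNReal.ofReal_lt_top

/-- For small `p` the expected number of visits exceeds `p` by at most a constant times `p ^ 2`. -/
theorem exists_expectedVisits_le (d : ℕ) [NeZero d] :
    ∃ q > (0 : ℝ), ∃ C ≥ (0 : ℝ), ∀ p : I, (p : ℝ) ≤ q →
      expectedVisits d p ≤ ENNReal.ofReal (p + C * p ^ 2) := by
  obtain ⟨q, hq, hlt⟩ := exists_visitSeries_lt_top d
  refine ⟨q, hq, (visitSeries d (ENNReal.ofReal q)).toReal, ENNReal.toReal_nonneg, fun p hp => ?_⟩
  have hp0 : (0 : ℝ) ≤ p := p.2.1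
  refine (expectedVisits_le p).trans ?_
  rw [ENNReal.ofReal_add hp0 (by positivity), ENNReal.ofReal_mul ENNReal.toReal_nonneg,
    ENNReal.ofReal_toReal hlt.ne, ENNReal.ofReal_pow hp0, mul_comm]
  gcongr
  exact visitSeries_mono d (ENNReal.ofReal_le_ofReal hp)

end Expectation

theorem theorem1p3 (d : ℕ) [NeZero d] :
    (∀ p : unitInterval,
      ENNReal.ofReal ((p : ℝ) + (p : ℝ) ^ 2) ≤ expectedVisits d p) ∧
    (∀ᶠ p : unitInterval in 𝓝[>] 0, expectedVisits d p < ∞) ∧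
    (fun p : unitInterval => (expectedVisits d p).toReal - (p : ℝ)) =O[𝓝[>] 0]
      (fun p : unitInterval =>
        (p : ℝ) ^ 2 * Real.log ((p : ℝ)⁻¹) ^ (((d : ℝ) + 2) / (d : ℝ))) := by
  obtain ⟨q, hq, C, hC, hle⟩ := exists_expectedVisits_le d
  have hsmall : ∀ r > (0 : ℝ), ∀ᶠ p : unitInterval in 𝓝[>] 0, (p : ℝ) ≤ r := fun r hr =>
    ((continuous_subtype_val.tendsto (0 : unitInterval)).mono_left nhdsWithin_le_nhds).eventually
      (eventually_le_nhds hr)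
  refine ⟨le_expectedVisits, ?_, ?_⟩
  · filter_upwards [hsmall q hq] with p hp
    exact (hle p hp).trans_lt ENNReal.ofReal_lt_top
  · refine IsBigO.of_bound C ?_
    -- For `p ≤ exp (-1)` the logarithmic factor is at least `1`, so the bound by `C * p ^ 2`
    -- suffices.
    filter_upwards [hsmall q hq, hsmall _ (Real.exp_pos (-1)), self_mem_nhdsWithin]
      with p hp hpe hp0
    have hp0' : (0 : ℝ) < p := hp0
    have hfin : expectedVisits d p ≠ ∞ := ((hle p hp).trans_lt ENNReal.ofReal_lt_top).ne
    have hlow : (p : ℝ) + (p : ℝ) ^ 2 ≤ (expectedVisits d p).toReal :=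
      (ENNReal.ofReal_le_iff_le_toReal hfin).1 (le_expectedVisits p)
    have hup : (expectedVisits d p).toReal ≤ p + C * (p : ℝ) ^ 2 :=
      ENNReal.toReal_le_of_le_ofReal (by positivity) (hle p hp)
    have hlog : 1 ≤ Real.log ((p : ℝ)⁻¹) := by
      rw [Real.log_inv, le_neg, Real.log_le_iff_le_exp hp0']
      exact hpe
    have hpow : 1 ≤ Real.log ((p : ℝ)⁻¹) ^ (((d : ℝ) + 2) / (d : ℝ)) :=
      Real.one_le_rpow hlog (by positivity)
    rw [Real.norm_of_nonneg (by nlinarith [sq_nonneg (p : ℝ)]),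
      Real.norm_of_nonneg (by positivity)]
    calc (expectedVisits d p).toReal - p ≤ C * ((p : ℝ) ^ 2 * 1) := by linarith
      _ ≤ _ := by gcongr
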